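/- Let $\mathcal X,\mathcal Z$ be complex Hilbert spaces, let $E,Q\colon\mathcal X\to\mathcal Z$ be bounded linear operators and let $A\colon\mathcal D(A)\subseteq\mathcal Z\to\mathcal Z$ be a closed, densely defined linear operator. Suppose that $(E,AQ)$ is a port-Hamiltonian DAE, i.e. $A$ is dissipative ($\operatorname{Re}\langle Az,z\rangle\le 0$ for all $z\in\mathcal D(A)$), $\operatorname{ran}E$ is closed, $Q$ is boundedly invertible, and $E^*Q=Q^*E\ge 0$. Here $AQ$ has the domain $\mathcal D(AQ)=\{x\in\mathcal X: Qx\in\mathcal D(A)\}$. Let $$\rho(E,AQ)=\{\lambda\in\mathbb C:\ \lambda E-AQ\colon\mathcal D(AQ)\to\mathcal Z \text{ is bijective with bounded inverse } (\lambda E-AQ)^{-1}\in L(\mathcal Z,\mathcal X)\},$$ and assume that there is $\omega>0$ with $\{\lambda\in\mathbb C:\operatorname{Re}\lambda>\omega\}\subseteq\rho(E,AQ)$. Then the complex resolvent index $p=p_{\mathrm{c,res}}^{(E,AQ)}$ exists, that is, there is a smallest $p\in\{0,1,2,\dots\}$ for which there are $\omega'\in\mathbb R$ and $C>0$ with $\{\operatorname{Re}\lambda>\omega'\}\subseteq\rho(E,AQ)$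 and $\|(\lambda E-AQ)^{-1}\|\le C|\lambda|^{p-1}$ whenever $\operatorname{Re}\lambda>\omega'$. Moreover, for every $\mu\in\rho(E,AQ)$ and every $x_0\in\operatorname{ran}\big((\mu E-AQ)^{-1}E\big)^{p+2}$ there exists a unique classical solution $x\colon[0,\infty)\to\mathcal X$ of $$\frac{d}{dt}Ex(t)=AQx(t),\quad t\ge 0,\qquad x(0)=x_0,$$ i.e. a unique function $x$ that is continuous on $[0,\infty)$, with $Ex(\cdot)$ continuously differentiable on $(0,\infty)$, $x(t)\in\mathcal D(AQ)$ for all $t\ge 0$, $x(0)=x_0$, and that satisfies the equation for all $t\ge 0$ (with the one-sided derivative at $t=0$). -/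

import Mathlib

namespace PHDAE

variable {X Z : Type*}
  [NormedAddCommGroup X] [InnerProductSpace ℂ X]
  [NormedAddCommGroup Z] [InnerProductSpace ℂ Z]

/-- The operator `A Q` with its natural domain `{x | Q x ∈ D(A)}`, for an unbounded operator `A`
in `Z` and a bounded operator `Q : X → Z`. -/
def mulBounded (A : Z →ₗ.[ℂ] Z) (Q : X →L[ℂ] Z) : X →ₗ.[ℂ] Z where
  domain := A.domain.comap (Q : X →ₗ[ℂ] Z)
  toFun :=
    { toFun := fun x => A ⟨Q x, x.2⟩
      map_add' := fun x y => by
        rw [← LinearPMap.map_add]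
        congr 1
        exact Subtype.ext (map_add Q (x : X) (y : X))
      map_smul' := fun c x => by
        rw [RingHom.id_apply, ← LinearPMap.map_smul]
        congr 1
        exact Subtype.ext (map_smul Q c (x : X)) }

/-- The bounded operator `S : Z → X` is the inverse of `s E - A : D(A) → Z`. -/
structure IsPencilInverse (E : X →L[ℂ] Z) (A : X →ₗ.[ℂ] Z) (s : ℂ) (S : Z →L[ℂ] X) : Prop where
  mem_domain : ∀ z, S z ∈ A.domain
  right_inv : ∀ z, s • E (S z) - A ⟨S z, mem_domain z⟩ = z
  left_inv : ∀ x : A.domain, S (s • E (x : X) - A x) = x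

/-- The resolvent set `ρ(E, A)`. -/
def resolventSet (E : X →L[ℂ] Z) (A : X →ₗ.[ℂ] Z) : Set ℂ :=
  {s | ∃ S : Z →L[ℂ] X, IsPencilInverse E A s S}

open Classical in
/-- The operator `(s E - A)⁻¹` for `s ∈ ρ(E, A)` (and `0` for other `s`). -/
noncomputable def pencilInverse (E : X →L[ℂ] Z) (A : X →ₗ.[ℂ] Z) (s : ℂ) : Z →L[ℂ] X :=
  if h : ∃ S : Z →L[ℂ] X, IsPencilInverse E A s S then h.choose else 0

theorem pencilInverse_spec {E : X →L[ℂ] Z} {A : X →ₗ.[ℂ] Z} {s : ℂ}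
    (hs : s ∈ resolventSet E A) : IsPencilInverse E A s (pencilInverse E A s) := by
  have h : ∃ S : Z →L[ℂ] X, IsPencilInverse E A s S := hs
  unfold pencilInverse
  rw [dif_pos h]
  exact h.choose_spec

theorem IsPencilInverse.eq_pencilInverse {E : X →L[ℂ] Z} {A : X →ₗ.[ℂ] Z} {s : ℂ}
    {S : Z →L[ℂ] X} (hS : IsPencilInverse E A s S) : S = pencilInverse E A s := by
  have hT := pencilInverse_spec (E := E) (A := A) (s := s) ⟨S, hS⟩
  ext z
  have h := hT.left_inv ⟨S z, hS.mem_domain z⟩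
  rw [hS.right_inv z] at h
  exact h.symm

/-- `p` is an admissible growth exponent: for some `ω ∈ ℝ` and `C > 0`, the half-plane `Re s > ω`
lies in `ρ(E, A)` and `‖(s E - A)⁻¹‖ ≤ C |s| ^ (p - 1)` there. -/
def HasComplexResolventGrowth (E : X →L[ℂ] Z) (A : X →ₗ.[ℂ] Z) (p : ℕ) : Prop :=
  ∃ ω C : ℝ, 0 < C ∧ ∀ s : ℂ, ω < s.re →
    s ∈ resolventSet E A ∧ ‖pencilInverse E A s‖ ≤ C * ‖s‖ ^ ((p : ℤ) - 1)

/-- The complex resolvent index of `(E, A)` exists and equals `p`. -/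
def IsComplexResolventIndex (E : X →L[ℂ] Z) (A : X →ₗ.[ℂ] Z) (p : ℕ) : Prop :=
  IsLeast {q : ℕ | HasComplexResolventGrowth E A q} p

/-- `x`, restricted to `[0, ∞)`, is a classical solution of `d/dt E x(t) = A x(t)`, `t ≥ 0`,
`x(0) = x₀`. The derivative at `t = 0` is one-sided. -/
structure IsClassicalSolution (E : X →L[ℂ] Z) (A : X →ₗ.[ℂ] Z) (x₀ : X) (x : ℝ → X) : Prop where
  continuousOn : ContinuousOn x (Set.Ici 0)
  contDiffOn : ContDiffOn ℝ 1 (fun t => E (x t)) (Set.Ioi 0)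
  mem_domain : ∀ t : ℝ, 0 ≤ t → x t ∈ A.domain
  initial : x 0 = x₀
  equation : ∀ (t : ℝ) (ht : 0 ≤ t),
    HasDerivWithinAt (fun τ => E (x τ)) (A ⟨x t, mem_domain t ht⟩) (Set.Ici 0) t

/-- `(E, A Q)` is a port-Hamiltonian differential-algebraic equation. -/
structure IsPortHamiltonian [CompleteSpace X] [CompleteSpace Z]
    (E Q : X →L[ℂ] Z) (A : Z →ₗ.[ℂ] Z) : Prop where
  closed : A.IsClosed
  dense_domain : Dense (A.domain : Set Z)
  dissipative : ∀ z : A.domain, (inner ℂ (A z) (z : Z)).re ≤ 0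
  closed_range : IsClosed (Set.range E)
  invertible : Q.IsInvertible
  symmetric : E.adjoint ∘L Q = Q.adjoint ∘L E
  nonneg : (E.adjoint ∘L Q).IsPositive

end PHDAE

/-!
Write `T = AQ`, `R(s) = (sE - T)⁻¹` and `K = R(μ)E`.

*The index.* By symmetry and positivity of `E*Q` and invertibility of `Q`, the energy `⟨Ex, Qx⟩`
dominates `‖Ex‖²` up to a constant (`IsPortHamiltonian.exists_norm_sq_le`). For `x = R(s)z`,
dissipativity of `A` gives `Re s · ⟨Ex, Qx⟩ ≤ Re ⟨z, Qx⟩`, hence `‖Ex‖² ≲ ‖z‖ ‖x‖` as long as `Re s`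
is bounded away from `0`. Inserted into the resolvent identity `x = R(r)z + (r - s) R(r)Ex` for a
fixed `r`, this yields `‖R(s)‖ ≲ |s|²`, so that `3` is an admissible exponent
(`IsPortHamiltonian.hasComplexResolventGrowth_three`) and a least one exists.

*Existence.* Iterating the resolvent identity splits the Laplace transform `R(s)Ex₀` of the solution
with initial value `x₀ = Kⁿy`, `n = p + 2`, into rational functions of `s` with values in the span
of `Ky, …, Kⁿy`, plus `(-1)ⁿ (s - μ)⁻ⁿ R(s)Ey`. The first part is inverted by an explicit formula
(`exists_solution_with_defect`). The second is `O(|s|⁻³)` on a half-plane, so its inverse Laplace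
integral `u` converges absolutely and may be differentiated once
(`exists_solution_of_inhomogeneous`). Here `u 0 = 0` by Cauchy's theorem
(`integral_vertLine_eq_zero`), and the inverse transform of `(s - μ)⁻ⁿ` comes from Fourier inversion
(`integral_exp_vertLine_mul_inv_pow`). Both parts solve the equation up to the same multiple of
`Ey`, with opposite signs.

*Uniqueness.* For the difference `x` of two solutions the energy `⟨Ex, Qx⟩` starts at `0`, is
nonnegative, and has derivative `2 Re ⟨AQx, Qx⟩ ≤ 0`. Hence `Ex = 0`, then `AQx = 0`, and `x = 0`
because `sE - AQ` is injective for some `s` (`IsPortHamiltonian.eq_zero_of_initial_zero`).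
-/

namespace PHDAE

open MeasureTheory Filter Topology Set Complex

section Laplace

/-! ### Absolutely convergent integrals along vertical lines -/

/-- The parametrisation `ξ ↦ γ + 2πiξ` of the vertical line `Re s = γ`; with this choice of
parameter the inverse Laplace integral carries no factor `1 / 2π`. -/
noncomputable def vertLine (γ ξ : ℝ) : ℂ := γ + (2 * Real.pi * ξ : ℝ) * I

@[simp] theorem vertLine_re (γ ξ : ℝ) : (vertLine γ ξ).re = γ := by simp [vertLine]

@[simp] theorem vertLine_im (γ ξ : ℝ) : (vertLine γ ξ).im = 2 * Real.pi * ξ := by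
  simp [vertLine]

theorem continuous_vertLine (γ : ℝ) : Continuous (vertLine γ) := by
  unfold vertLine; fun_prop

theorem one_add_sq_le_norm_vertLine_sq {γ : ℝ} (hγ : 1 ≤ γ) (ξ : ℝ) :
    1 + ξ ^ 2 ≤ ‖vertLine γ ξ‖ ^ 2 := by
  rw [← Complex.normSq_eq_norm_sq, Complex.normSq_apply, vertLine_re, vertLine_im]
  nlinarith [mul_nonneg (sub_nonneg.2 Real.pi_gt_three.le) (sq_nonneg ξ), Real.pi_gt_three,
    mul_nonneg (mul_nonneg (sub_nonneg.2 Real.pi_gt_three.le) (sq_nonneg ξ)) Real.pi_pos.le,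
    sq_nonneg ξ]

/-- A continuous function on the line that decays like `|s|⁻²` is integrable. -/
theorem integrable_of_norm_le_vertLine {V : Type*} [NormedAddCommGroup V] {γ C : ℝ}
    (hγ : 1 ≤ γ) {g : ℝ → V} (hg : Continuous g)
    (hb : ∀ ξ, ‖g ξ‖ ≤ C * (‖vertLine γ ξ‖ ^ 2)⁻¹) : Integrable g := by
  have hC : 0 ≤ C := by
    have h := (norm_nonneg _).trans (hb 0)
    have h1 : 0 < (‖vertLine γ 0‖ ^ 2)⁻¹ := by
      have := one_add_sq_le_norm_vertLine_sq hγ 0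
      have : 0 < ‖vertLine γ 0‖ ^ 2 := by nlinarith
      positivity
    exact nonneg_of_mul_nonneg_left h h1
  refine (integrable_inv_one_add_sq.const_mul C).mono' hg.aestronglyMeasurable
    (ae_of_all _ fun ξ => (hb ξ).trans ?_)
  have := one_add_sq_le_norm_vertLine_sq hγ ξ
  gcongr

theorem exp_mul_le_of_mem_ball (γ : ℝ) {s t : ℝ} (hs : s ∈ Metric.ball t 1) :
    Real.exp (s * γ) ≤ Real.exp ((|t| + 1) * |γ|) := by
  have h1 : |s| ≤ |t| + 1 := by
    have h := abs_sub_abs_le_abs_sub s t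
    have h2 : |s - t| < 1 := by simpa [Real.dist_eq] using hs
    linarith
  refine Real.exp_le_exp.2 ?_
  calc s * γ ≤ |s * γ| := le_abs_self _
    _ = |s| * |γ| := abs_mul _ _
    _ ≤ _ := by gcongr

variable {V : Type*} [NormedAddCommGroup V] [NormedSpace ℂ V]

theorem norm_exp_mul_vertLine (γ t ξ : ℝ) :
    ‖cexp (t * vertLine γ ξ)‖ = Real.exp (t * γ) := by
  rw [Complex.norm_exp]; simp

theorem integrable_exp_vertLine_smul (γ t : ℝ) {g : ℝ → V} (hg : Integrable g) :
    Integrable fun ξ => cexp (t * vertLine γ ξ) • g ξ := by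
  have hc := continuous_vertLine γ
  refine (hg.norm.const_mul (Real.exp (t * γ))).mono'
    ((by fun_prop : Continuous fun ξ => cexp (t * vertLine γ ξ)).aestronglyMeasurable.smul
      hg.aestronglyMeasurable) (ae_of_all _ fun ξ => ?_)
  rw [norm_smul, norm_exp_mul_vertLine]

theorem hasDerivAt_integral_exp_vertLine_smul (γ t : ℝ) {g : ℝ → V} (hg : Integrable g)
    (hg' : Integrable fun ξ => vertLine γ ξ • g ξ) :
    HasDerivAt (fun t : ℝ => ∫ ξ, cexp (t * vertLine γ ξ) • g ξ)
      (∫ ξ, cexp (t * vertLine γ ξ) • vertLine γ ξ • g ξ) t := by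
  refine (hasDerivAt_integral_of_dominated_loc_of_deriv_le (μ := volume)
    (F := fun (t : ℝ) ξ => cexp (t * vertLine γ ξ) • g ξ)
    (F' := fun (t : ℝ) ξ => cexp (t * vertLine γ ξ) • vertLine γ ξ • g ξ)
    (bound := fun ξ => Real.exp ((|t| + 1) * |γ|) * ‖vertLine γ ξ • g ξ‖)
    (Metric.ball_mem_nhds t one_pos)
    (Eventually.of_forall fun s => (integrable_exp_vertLine_smul γ s hg).aestronglyMeasurable)
    (integrable_exp_vertLine_smul γ t hg)
    (integrable_exp_vertLine_smul γ t hg').aestronglyMeasurable ?_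
    (hg'.norm.const_mul _) ?_).2
  · refine ae_of_all _ fun ξ s hs => ?_
    rw [norm_smul, norm_exp_mul_vertLine]
    exact mul_le_mul_of_nonneg_right (exp_mul_le_of_mem_ball γ hs) (norm_nonneg _)
  · refine ae_of_all _ fun ξ s _ => ?_
    have h : HasDerivAt (fun s : ℝ => cexp (s * vertLine γ ξ))
        (cexp (s * vertLine γ ξ) * vertLine γ ξ) s := by
      have h1 : HasDerivAt (fun s : ℝ => (s : ℂ) * vertLine γ ξ) (vertLine γ ξ) s := by
        simpa using (Complex.ofRealCLM.hasDerivAt (x := s)).mul_const (vertLine γ ξ)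
      exact h1.cexp
    simpa [mul_smul] using h.smul_const (g ξ)

theorem continuous_integral_exp_vertLine_smul (γ : ℝ) {g : ℝ → V} (hg : Integrable g) :
    Continuous fun t : ℝ => ∫ ξ, cexp (t * vertLine γ ξ) • g ξ := by
  refine continuous_iff_continuousAt.2 fun t => ?_
  refine continuousAt_of_dominated (bound := fun ξ => Real.exp ((|t| + 1) * |γ|) * ‖g ξ‖)
    (Eventually.of_forall fun s => (integrable_exp_vertLine_smul γ s hg).aestronglyMeasurable)
    ?_ (hg.norm.const_mul _) (ae_of_all _ fun ξ => by fun_prop)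
  filter_upwards [Metric.ball_mem_nhds t one_pos] with s hs
  refine ae_of_all _ fun ξ => ?_
  rw [norm_smul, norm_exp_mul_vertLine]
  exact mul_le_mul_of_nonneg_right (exp_mul_le_of_mem_ball γ hs) (norm_nonneg _)

/-! ### Contour integrals and the inverse Laplace transform of powers -/

/-- Cauchy's theorem for a right half-plane: the integral along the boundary line of a function
that is holomorphic in the half-plane and decays like `|s|⁻²` vanishes. It is compared with the
integral over the other three sides of the rectangle `[γ, γ + T] × [-T, T]`, which is `O(T⁻¹)`. -/
theorem integral_vertLine_eq_zero [CompleteSpace V] {γ C : ℝ} (hγ : 1 ≤ γ) {F : ℂ → V}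
    (hF : ∀ s : ℂ, γ ≤ s.re → DifferentiableAt ℂ F s)
    (hb : ∀ s : ℂ, γ ≤ s.re → ‖F s‖ ≤ C * (‖s‖ ^ 2)⁻¹) :
    ∫ ξ, F (vertLine γ ξ) = 0 := by
  have hcont : Continuous fun ξ => F (vertLine γ ξ) := continuous_iff_continuousAt.2 fun ξ =>
    ContinuousAt.comp (f := vertLine γ) (hF (vertLine γ ξ) (by simp)).continuousAt
      (continuous_vertLine γ).continuousAt
  have hint : Integrable fun ξ => F (vertLine γ ξ) :=
    integrable_of_norm_le_vertLine hγ hcont fun ξ => hb _ (by simp)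
  have hpi : (2 * Real.pi) ≠ 0 := by positivity
  set G : ℝ → V := fun y => F (γ + y * I) with hG
  have hGF : (fun ξ => F (vertLine γ ξ)) = fun ξ => G ((2 * Real.pi) * ξ) := by
    ext ξ; simp [hG, vertLine]
  have hGint : Integrable G := by
    rw [hGF] at hint
    exact (integrable_comp_mul_left_iff G hpi).1 hint
  have hC : 0 ≤ C := by
    have h := (norm_nonneg _).trans (hb γ (by simp))
    refine nonneg_of_mul_nonneg_left h ?_
    have : (γ : ℂ) ≠ 0 := by exact_mod_cast (by linarith : γ ≠ 0)
    positivity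
  have hlim : Tendsto (fun T : ℝ => ∫ y in (-T)..T, G y) atTop (𝓝 (∫ y, G y)) :=
    intervalIntegral_tendsto_integral hGint tendsto_neg_atTop_atBot tendsto_id
  have hzero : Tendsto (fun T : ℝ => ∫ y in (-T)..T, G y) atTop (𝓝 0) := by
    refine squeeze_zero_norm' (a := fun T : ℝ => (4 * C) * T⁻¹) ?_ ?_
    · filter_upwards [eventually_gt_atTop 0] with T hT
      have hbT : ∀ s : ℂ, γ ≤ s.re → T ≤ ‖s‖ → ‖F s‖ ≤ C * (T ^ 2)⁻¹ := fun s h1 h2 =>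
        (hb s h1).trans (by gcongr)
      have hrect := Complex.integral_boundary_rect_eq_zero_of_differentiableOn F
        (γ + (-T : ℝ) * I) ((γ + T : ℝ) + (T : ℝ) * I) (by
          intro s hs
          refine (hF s ?_).differentiableWithinAt
          have := hs.1
          simp only [mem_preimage, add_re, ofReal_re, mul_re, I_re, mul_zero, ofReal_im, I_im,
            mul_one, sub_self, add_zero] at this
          rw [uIcc_of_le (by linarith)] at this
          exact this.1)
      simp only [add_re, ofReal_re, mul_re, I_re, mul_zero, ofReal_im, I_im,
            mul_one, sub_self, add_zero, add_im, mul_im, zero_add] at hrect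
      have h1 : ‖∫ x : ℝ in γ..(γ + T), F (x + (-T : ℝ) * I)‖ ≤ C * (T ^ 2)⁻¹ * |γ + T - γ| := by
        refine intervalIntegral.norm_integral_le_of_norm_le_const fun x hx => ?_
        rw [uIoc_of_le (by linarith)] at hx
        refine hbT _ (by simpa using hx.1.le) ?_
        refine le_trans ?_ (Complex.abs_im_le_norm _)
        simp [le_abs_self]
      have h2 : ‖∫ x : ℝ in γ..(γ + T), F (x + (T : ℝ) * I)‖ ≤ C * (T ^ 2)⁻¹ * |γ + T - γ| := by
        refine intervalIntegral.norm_integral_le_of_norm_le_const fun x hx => ?_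
        rw [uIoc_of_le (by linarith)] at hx
        refine hbT _ (by simpa using hx.1.le) ?_
        refine le_trans ?_ (Complex.abs_im_le_norm _)
        simp [le_abs_self]
      have h3 : ‖∫ y : ℝ in (-T)..T, F ((γ + T : ℝ) + y * I)‖ ≤ C * (T ^ 2)⁻¹ * |T - (-T)| := by
        refine intervalIntegral.norm_integral_le_of_norm_le_const fun x hx => ?_
        refine hbT _ (by simpa using hT.le) ?_
        refine le_trans ?_ (Complex.abs_re_le_norm _)
        simp only [add_re, ofReal_re, mul_re, I_re, mul_zero, ofReal_im, I_im, mul_one,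
          sub_self, add_zero]
        exact (by linarith : T ≤ γ + T).trans (le_abs_self _)
      have h4 : ‖∫ y in (-T)..T, G y‖ = ‖(∫ x : ℝ in γ..(γ + T), F (x + (-T : ℝ) * I)) -
          (∫ x : ℝ in γ..(γ + T), F (x + (T : ℝ) * I)) +
          I • ∫ y : ℝ in (-T)..T, F ((γ + T : ℝ) + y * I)‖ := by
        rw [sub_eq_zero.1 hrect, norm_smul, norm_I, one_mul]
      rw [h4]
      refine (norm_add_le_of_le (norm_sub_le_of_le h1 h2)
        ((norm_smul _ _).le.trans ((congrArg (· * _) norm_I).le.trans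
          ((one_mul _).le.trans h3)))).trans (le_of_eq ?_)
      rw [show γ + T - γ = T by ring, show T - (-T) = 2 * T by ring, abs_of_pos hT,
        abs_of_pos (by positivity)]
      field_simp
      norm_num
    · simpa using tendsto_inv_atTop_zero.const_mul (4 * C)
  have h0 : ∫ y, G y = 0 := tendsto_nhds_unique hlim hzero
  rw [hGF, Measure.integral_comp_mul_left, h0, smul_zero]

theorem integrableOn_pow_mul_exp_neg (n : ℕ) {a : ℂ} (ha : 0 < a.re) :
    IntegrableOn (fun t : ℝ => (t : ℂ) ^ n * cexp (-(a * t))) (Ioi 0) := by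
  have h := integrableOn_rpow_mul_exp_neg_mul_rpow (p := 1) (s := n) (b := a.re)
    (by have := n.cast_nonneg (α := ℝ); linarith) one_pos ha
  refine Integrable.mono' h
    (Continuous.aestronglyMeasurable (by fun_prop))
    (ae_restrict_of_forall_mem measurableSet_Ioi fun t ht => le_of_eq ?_)
  rw [norm_mul, norm_pow, Complex.norm_real, Real.norm_of_nonneg (le_of_lt ht), Complex.norm_exp,
    Real.rpow_one, Real.rpow_natCast]
  simp

theorem integral_pow_mul_exp_neg_Ioi (n : ℕ) {a : ℂ} (ha : 0 < a.re) :
    ∫ t : ℝ in Ioi 0, (t : ℂ) ^ n * cexp (-(a * t)) = n.factorial / a ^ (n + 1) := by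
  have ha0 : a ≠ 0 := by rintro rfl; simp at ha
  have htend : ∀ n : ℕ, Tendsto (fun t : ℝ => (t : ℂ) ^ n * cexp (-(a * t))) atTop (𝓝 0) := by
    intro n
    have h := tendsto_rpow_mul_exp_neg_mul_atTop_nhds_zero n a.re ha
    refine tendsto_zero_iff_norm_tendsto_zero.2 (h.congr' ?_)
    filter_upwards [eventually_gt_atTop 0] with t ht
    rw [norm_mul, norm_pow, Complex.norm_real, Real.norm_of_nonneg ht.le, Complex.norm_exp,
      Real.rpow_natCast]
    simp
  have hderivexp : ∀ t : ℝ, HasDerivAt (fun t : ℝ => cexp (-(a * t))) (cexp (-(a * t)) * -a) t := by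
    intro t
    have h1 : HasDerivAt (fun t : ℝ => -(a * (t : ℂ))) (-a) t := by
      simpa using ((Complex.ofRealCLM.hasDerivAt (x := t)).const_mul a).fun_neg
    exact h1.cexp
  induction n with
  | zero =>
    have h := integral_Ioi_of_hasDerivAt_of_tendsto (a := 0)
      (f := fun t : ℝ => -a⁻¹ * cexp (-(a * t))) (f' := fun t : ℝ => (t : ℂ) ^ 0 * cexp (-(a * t)))
      (m := 0) (Continuous.continuousWithinAt (by fun_prop))
      (fun t _ => ((hderivexp t).const_mul (-a⁻¹)).congr_deriv (by field_simp))
      (integrableOn_pow_mul_exp_neg 0 ha)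
      (by simpa using (htend 0).const_mul (-a⁻¹))
    rw [h]; simp
  | succ n ih =>
    have hI1 := integrableOn_pow_mul_exp_neg (n + 1) ha
    have hI0 := (integrableOn_pow_mul_exp_neg n ha).const_mul ((n + 1 : ℂ) / a)
    have h := integral_Ioi_of_hasDerivAt_of_tendsto (a := 0)
      (f := fun t : ℝ => -a⁻¹ * ((t : ℂ) ^ (n + 1) * cexp (-(a * t))))
      (f' := fun t : ℝ => (t : ℂ) ^ (n + 1) * cexp (-(a * t)) -
        (n + 1 : ℂ) / a * ((t : ℂ) ^ n * cexp (-(a * t))))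
      (m := 0) (Continuous.continuousWithinAt (by fun_prop))
      (fun t _ => by
        have hp : HasDerivAt (fun t : ℝ => (t : ℂ) ^ (n + 1)) ((n + 1 : ℂ) * (t : ℂ) ^ n) t := by
          simpa using (Complex.ofRealCLM.hasDerivAt (x := t)).fun_pow (n + 1)
        exact ((hp.fun_mul (hderivexp t)).const_mul (-a⁻¹)).congr_deriv (by field_simp; ring))
      (hI1.sub hI0)
      (by simpa using (htend (n + 1)).const_mul (-a⁻¹))
    rw [integral_sub hI1 hI0, integral_const_mul, ih] at h
    simp only [ofReal_zero, ne_eq, Nat.add_eq_zero_iff, one_ne_zero, and_false, not_false_eq_true,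
      zero_pow, zero_mul, mul_zero, sub_zero, sub_eq_zero] at h
    rw [h, Nat.factorial_succ]
    push_cast
    field_simp
    ring

/-- Far to the right of `μ`, the distance to `μ` is comparable with the modulus. -/
theorem norm_div_two_le_norm_sub {μ s : ℂ} (h : 2 * ‖μ‖ ≤ s.re) : ‖s‖ / 2 ≤ ‖s - μ‖ := by
  have h1 := norm_sub_norm_le s μ
  have h2 := (le_abs_self _).trans (Complex.abs_re_le_norm s)
  linarith

theorem norm_inv_pow_sub_le {μ s : ℂ} (h : 2 * ‖μ‖ ≤ s.re) (hs : 0 < s.re) (n : ℕ) :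
    ‖((s - μ) ^ n)⁻¹‖ ≤ 2 ^ n * (‖s‖ ^ n)⁻¹ := by
  have h1 := norm_div_two_le_norm_sub h
  have h2 : 0 < ‖s‖ := hs.trans_le ((le_abs_self _).trans (Complex.abs_re_le_norm s))
  rw [norm_inv, norm_pow]
  calc (‖s - μ‖ ^ n)⁻¹ ≤ ((‖s‖ / 2) ^ n)⁻¹ := by gcongr
    _ = _ := by rw [div_pow, inv_div, div_eq_mul_inv]

theorem sub_ne_zero_of_re {μ s : ℂ} (h : 2 * ‖μ‖ ≤ s.re) (hs : 0 < s.re) : s - μ ≠ 0 := by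
  have h1 := norm_div_two_le_norm_sub h
  have h2 : 0 < ‖s‖ := hs.trans_le ((le_abs_self _).trans (Complex.abs_re_le_norm s))
  exact norm_pos_iff.1 (by linarith)

theorem continuous_inv_pow_vertLine_sub {γ : ℝ} (hγ : 1 ≤ γ) {μ : ℂ} (hμ : 2 * ‖μ‖ ≤ γ)
    (n : ℕ) : Continuous fun ξ => ((vertLine γ ξ - μ) ^ n)⁻¹ :=
  (((continuous_vertLine γ).sub continuous_const).pow n).inv₀ fun ξ =>
    pow_ne_zero _ (sub_ne_zero_of_re (by simpa using hμ) (by simp; linarith))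

theorem integrable_inv_pow_vertLine_sub {γ : ℝ} (hγ : 1 ≤ γ) {μ : ℂ} (hμ : 2 * ‖μ‖ ≤ γ)
    {n : ℕ} (hn : 2 ≤ n) : Integrable fun ξ => ((vertLine γ ξ - μ) ^ n)⁻¹ := by
  refine integrable_of_norm_le_vertLine (V := ℂ) (C := 2 ^ n) hγ
    (continuous_inv_pow_vertLine_sub hγ hμ n) fun ξ => ?_
  refine (norm_inv_pow_sub_le (by simpa using hμ) (by simp; linarith) n).trans ?_
  have h1 : 1 ≤ ‖vertLine γ ξ‖ := by
    nlinarith [one_add_sq_le_norm_vertLine_sq hγ ξ, norm_nonneg (vertLine γ ξ)]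
  gcongr

/-- The inverse Laplace transform of `(s - μ)⁻ⁿ⁻¹` is `tⁿ e^{μt} / n!`, by Fourier inversion applied
to `t ↦ tⁿ e^{(μ - γ) t}` extended by `0` to the left. -/
theorem integral_exp_vertLine_mul_inv_pow {γ : ℝ} (hγ : 1 ≤ γ) {μ : ℂ} (hμ : 2 * ‖μ‖ ≤ γ)
    {n : ℕ} (hn : 1 ≤ n) {t : ℝ} (ht : 0 ≤ t) :
    ∫ ξ, cexp (t * vertLine γ ξ) * ((vertLine γ ξ - μ) ^ (n + 1))⁻¹ =
      (t : ℂ) ^ n / n.factorial * cexp (μ * t) := by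
  have hμre : μ.re < γ := by
    have := (le_abs_self _).trans (Complex.abs_re_le_norm μ)
    have := norm_nonneg μ
    by_contra! h
    linarith
  have ha : 0 < ((γ : ℂ) - μ).re := by simpa using hμre
  set f : ℝ → ℂ := fun t => ((max t 0 : ℝ) : ℂ) ^ n * cexp (-(((γ : ℂ) - μ) * t)) with hf
  have hfind : f = (Ioi (0 : ℝ)).indicator
      fun t : ℝ => (t : ℂ) ^ n * cexp (-(((γ : ℂ) - μ) * t)) := by
    ext s
    by_cases hs : s ∈ Ioi (0 : ℝ)
    · rw [indicator_of_mem hs]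
      simp only [hf, max_eq_left (le_of_lt (mem_Ioi.1 hs))]
    · rw [indicator_of_notMem hs]
      simp only [hf, max_eq_right (notMem_Ioi.1 hs), ofReal_zero,
        zero_pow (by omega : n ≠ 0), zero_mul]
  have hfc : Continuous f := by
    have : Continuous fun t : ℝ => ((max t 0 : ℝ) : ℂ) :=
      continuous_ofReal.comp (continuous_id.max continuous_const)
    fun_prop
  have hfi : Integrable f := by
    rw [hfind, integrable_indicator_iff measurableSet_Ioi]
    exact integrableOn_pow_mul_exp_neg n ha
  have hfour : FourierTransform.fourier f =
      fun ξ => (n.factorial : ℂ) * ((vertLine γ ξ - μ) ^ (n + 1))⁻¹ := by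
    ext ξ
    rw [Real.fourier_real_eq_integral_exp_smul, ← div_eq_mul_inv,
      ← integral_pow_mul_exp_neg_Ioi n (by simpa using hμre : 0 < (vertLine γ ξ - μ).re),
      ← integral_indicator measurableSet_Ioi]
    congr 1
    ext s
    rw [hfind]
    by_cases hs : s ∈ Ioi (0 : ℝ)
    · rw [indicator_of_mem hs, indicator_of_mem hs, smul_eq_mul, mul_left_comm, ← Complex.exp_add]
      congr 2
      simp only [vertLine]
      push_cast
      ring
    · rw [indicator_of_notMem hs, indicator_of_notMem hs, smul_zero]
  -- `f` is continuous at `0` because `n ≥ 1`, so the inversion formula holds at every point.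
  have hinv := congrFun (hfc.fourierInv_fourier_eq hfi (by
    rw [hfour]
    exact (integrable_inv_pow_vertLine_sub hγ hμ (by omega)).const_mul _)) t
  rw [Real.fourierInv_eq', hfour] at hinv
  have hn0 : (n.factorial : ℂ) ≠ 0 := by exact_mod_cast n.factorial_ne_zero
  have hexp : ∀ ξ, cexp (t * vertLine γ ξ) * ((vertLine γ ξ - μ) ^ (n + 1))⁻¹ =
      (cexp (t * γ) / n.factorial) * (cexp (↑(2 * Real.pi * inner ℝ ξ t) * I) •
        ((n.factorial : ℂ) * ((vertLine γ ξ - μ) ^ (n + 1))⁻¹)) := by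
    intro ξ
    have : cexp (t * vertLine γ ξ) =
        cexp (t * γ) * cexp (↑(2 * Real.pi * inner ℝ ξ t) * I) := by
      rw [← Complex.exp_add]
      congr 1
      simp only [vertLine, RCLike.inner_apply, conj_trivial]
      push_cast
      ring
    rw [this, smul_eq_mul]
    field_simp
  simp_rw [hexp]
  rw [integral_const_mul, hinv]
  simp only [hf, max_eq_left ht]
  rw [show cexp (μ * t) = cexp (t * γ) * cexp (-(((γ : ℂ) - μ) * t)) by
    rw [← Complex.exp_add]; congr 1; ring]
  ring

end Laplace

section Pencil

/-! ### The resolvent of an operator pencil -/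

variable {X Z : Type*}
  [NormedAddCommGroup X] [InnerProductSpace ℂ X]
  [NormedAddCommGroup Z] [InnerProductSpace ℂ Z]
  {E : X →L[ℂ] Z} {T : X →ₗ.[ℂ] Z}

theorem mem_graph_pencilInverse {s : ℂ} (hs : s ∈ resolventSet E T) (z : Z) :
    (pencilInverse E T s z, s • E (pencilInverse E T s z) - z) ∈ T.graph := by
  have h := pencilInverse_spec hs
  refine T.mem_graph_iff.2 ⟨⟨_, h.mem_domain z⟩, rfl, ?_⟩
  have := h.right_inv z
  rw [sub_eq_iff_eq_add] at this
  simp only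
  rw [this]
  abel

theorem pencilInverse_of_mem_graph {s : ℂ} (hs : s ∈ resolventSet E T) {x : X} {w : Z}
    (h : (x, w) ∈ T.graph) : pencilInverse E T s (s • E x - w) = x := by
  obtain ⟨y, rfl, rfl⟩ := T.mem_graph_iff.1 h
  exact (pencilInverse_spec hs).left_inv y

/-- The resolvent identity. -/
theorem pencilInverse_sub_pencilInverse {s r : ℂ} (hs : s ∈ resolventSet E T)
    (hr : r ∈ resolventSet E T) (z : Z) :
    pencilInverse E T s z - pencilInverse E T r z =
      (r - s) • pencilInverse E T s (E (pencilInverse E T r z)) := by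
  have h := pencilInverse_of_mem_graph hs (mem_graph_pencilInverse hr z)
  conv_lhs => rw [← h]
  simp only [map_sub, map_smul, sub_smul]
  abel

/-- Near a point where the resolvent is locally bounded, it is strongly holomorphic. -/
theorem differentiableAt_pencilInverse {r : ℂ} {M : ℝ}
    (h : ∀ᶠ s in 𝓝 r, s ∈ resolventSet E T ∧ ‖pencilInverse E T s‖ ≤ M) (z : Z) :
    DifferentiableAt ℂ (fun s => pencilInverse E T s z) r := by
  have hr := h.self_of_nhds.1
  have hcont : ∀ w : Z, Tendsto (fun s => pencilInverse E T s w) (𝓝 r)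
      (𝓝 (pencilInverse E T r w)) := by
    intro w
    refine tendsto_iff_norm_sub_tendsto_zero.2 (squeeze_zero'
      (g := fun s => ‖r - s‖ * (M * ‖E (pencilInverse E T r w)‖))
      (Eventually.of_forall fun _ => norm_nonneg _) ?_ ?_)
    · filter_upwards [h] with s hs
      rw [pencilInverse_sub_pencilInverse hs.1 hr, norm_smul]
      gcongr
      exact ContinuousLinearMap.le_of_opNorm_le _ hs.2 _
    · have : Continuous fun s => ‖r - s‖ * (M * ‖E (pencilInverse E T r w)‖) := by fun_prop
      simpa using this.tendsto r
  refine HasDerivAt.differentiableAt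
    (f' := -pencilInverse E T r (E (pencilInverse E T r z))) ?_
  rw [hasDerivAt_iff_tendsto_slope]
  refine ((hcont (E (pencilInverse E T r z))).neg.mono_left nhdsWithin_le_nhds).congr' ?_
  filter_upwards [self_mem_nhdsWithin, mem_nhdsWithin_of_mem_nhds h] with s hs hs'
  have hne : s - r ≠ 0 := sub_ne_zero.2 hs
  rw [slope_def_module, pencilInverse_sub_pencilInverse hs'.1 hr, smul_smul,
    show (s - r)⁻¹ * (r - s) = -1 by field_simp; ring, neg_one_smul]

/-- A half-plane contained in the resolvent set on which the resolvent has polynomial growth is a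
domain of strong holomorphy. -/
theorem differentiableAt_pencilInverse_of_growth {p : ℕ} {ω C : ℝ}
    (h : ∀ s : ℂ, ω < s.re → s ∈ resolventSet E T ∧
      ‖pencilInverse E T s‖ ≤ C * ‖s‖ ^ ((p : ℤ) - 1)) {r : ℂ} (hr : ω < r.re) (hr0 : r ≠ 0)
    (z : Z) : DifferentiableAt ℂ (fun s => pencilInverse E T s z) r := by
  have hc : ContinuousAt (fun s : ℂ => C * ‖s‖ ^ ((p : ℤ) - 1)) r :=
    continuousAt_const.mul (continuousAt_id.norm.zpow₀ _ (Or.inl (norm_ne_zero_iff.2 hr0)))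
  refine differentiableAt_pencilInverse (M := C * ‖r‖ ^ ((p : ℤ) - 1) + 1) ?_ z
  filter_upwards [hc.eventually (gt_mem_nhds (lt_add_one _)),
    (Complex.continuous_re.tendsto r).eventually (lt_mem_nhds hr)] with s h1 h2
  exact ⟨(h s h2).1, (h s h2).2.trans h1.le⟩

/-! ### Construction of classical solutions -/

/-- The part of the solution in the span of `K y, …, Kⁿ⁺¹ y`, `K = (μE - T)⁻¹E`. It is
`∑ₖ (-t)ᵏ/k! e^{μt} Kⁿ⁺¹⁻ᵏ y`, built by recursion on `n`, and it solves the equation with initial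
value `Kⁿ⁺¹ y` up to the defect `(-t)ⁿ/n! e^{μt} E y`. -/
theorem exists_solution_with_defect {μ : ℂ} (hμ : μ ∈ resolventSet E T) (n : ℕ) (y : X) :
    ∃ (v : ℝ → X) (d : ℝ → Z), Continuous v ∧ Continuous d ∧
      v 0 = ((pencilInverse E T μ ∘L E) ^ (n + 1) : X →L[ℂ] X) y ∧
      ∀ t : ℝ, HasDerivAt (fun t => E (v t)) (d t) t ∧
        (v t, d t - ((-t : ℂ) ^ n / n.factorial * cexp (μ * t)) • E y) ∈ T.graph := by
  set K := pencilInverse E T μ ∘L E with hK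
  have hKg : ∀ w, (K w, μ • E (K w) - E w) ∈ T.graph := fun w =>
    mem_graph_pencilInverse hμ (E w)
  have hexp : ∀ t : ℝ, HasDerivAt (fun t : ℝ => cexp (μ * t)) (cexp (μ * t) * μ) t := fun t => by
    have h1 : HasDerivAt (fun t : ℝ => μ * (t : ℂ)) μ t := by
      simpa using (Complex.ofRealCLM.hasDerivAt (x := t)).const_mul μ
    exact h1.cexp
  induction n generalizing y with
  | zero =>
    refine ⟨fun t => cexp (μ * t) • K y, fun t => (cexp (μ * t) * μ) • E (K y), by fun_prop,
      by fun_prop, by simp, fun t => ⟨?_, ?_⟩⟩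
    · simpa using (hexp t).smul_const (E (K y))
    · have := T.graph.smul_mem (cexp (μ * t)) (hKg y)
      simpa [smul_sub, smul_smul] using this
  | succ n ih =>
    obtain ⟨v, d, hv, hd, h0, h⟩ := ih (K y)
    have ha : ∀ t : ℝ, HasDerivAt
        (fun t : ℝ => (-t : ℂ) ^ (n + 1) / (n + 1).factorial * cexp (μ * t))
        (μ * ((-t : ℂ) ^ (n + 1) / (n + 1).factorial * cexp (μ * t)) -
          (-t : ℂ) ^ n / n.factorial * cexp (μ * t)) t := by
      intro t
      have h1 : HasDerivAt (fun t : ℝ => (-t : ℂ) ^ (n + 1)) (-((n + 1 : ℂ) * (-t : ℂ) ^ n)) t := by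
        simpa using (Complex.ofRealCLM.hasDerivAt (x := t)).fun_neg.fun_pow (n + 1)
      refine ((h1.div_const ((n + 1).factorial : ℂ)).fun_mul (hexp t)).congr_deriv ?_
      have : (n.factorial : ℂ) ≠ 0 := by exact_mod_cast n.factorial_ne_zero
      have : (n + 1 : ℂ) ≠ 0 := by exact_mod_cast n.succ_ne_zero
      rw [Nat.factorial_succ]
      push_cast
      field_simp
      ring
    refine ⟨fun t => v t + ((-t : ℂ) ^ (n + 1) / (n + 1).factorial * cexp (μ * t)) • K y,
      fun t => d t + (μ * ((-t : ℂ) ^ (n + 1) / (n + 1).factorial * cexp (μ * t)) -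
          (-t : ℂ) ^ n / n.factorial * cexp (μ * t)) • E (K y), by fun_prop, by fun_prop, ?_,
      fun t => ⟨?_, ?_⟩⟩
    · rw [pow_succ]
      simp [h0]
    · simpa using (h t).1.fun_add ((ha t).smul_const (E (K y)))
    · have := T.graph.add_mem (h t).2 (T.graph.smul_mem
        ((-t : ℂ) ^ (n + 1) / (n + 1).factorial * cexp (μ * t)) (hKg y))
      convert this using 1
      refine Prod.ext rfl ?_
      simp only [Prod.snd_add, Prod.smul_snd, smul_sub, sub_smul, smul_smul]
      rw [mul_comm μ]
      abel

/-- The inverse Laplace integral of `(s - μ)⁻ᵖ⁻² (sE - T)⁻¹E y` starts at `0` and solves the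
equation with the inhomogeneity `tᵖ⁺¹/(p+1)! e^{μt} E y`. The integrand is `O(|s|⁻³)`, which leaves
room for one time derivative. -/
theorem exists_solution_of_inhomogeneous [CompleteSpace X] [CompleteSpace Z] {p : ℕ}
    (hp : HasComplexResolventGrowth E T p) {μ : ℂ} (hμ : μ ∈ resolventSet E T) (y : X) :
    ∃ (u : ℝ → X) (d : ℝ → Z), Continuous u ∧ Continuous d ∧ u 0 = 0 ∧
      ∀ t : ℝ, HasDerivAt (fun t => E (u t)) (d t) t ∧ (0 ≤ t →
        (u t, d t - ((t : ℂ) ^ (p + 1) / (p + 1).factorial * cexp (μ * t)) • E y) ∈ T.graph) := by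
  obtain ⟨ω, C, hC, hg⟩ := hp
  -- The line lies in the half-plane of polynomial growth, and `|s - μ| ≥ |s| / 2` to its right.
  set γ : ℝ := |ω| + 2 * ‖μ‖ + 1 with hγdef
  have hωγ : ω < γ := by
    have := le_abs_self ω; have := norm_nonneg μ; linarith
  have hγ : 1 ≤ γ := by
    have := abs_nonneg ω; have := norm_nonneg μ; linarith
  have hμγ : 2 * ‖μ‖ ≤ γ := by
    have := abs_nonneg ω; linarith
  have hpos : ∀ s : ℂ, γ ≤ s.re → 1 ≤ ‖s‖ := fun s hs =>
    hγ.trans (hs.trans ((le_abs_self _).trans (Complex.abs_re_le_norm s)))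
  set F : ℂ → X := fun s => ((s - μ) ^ (p + 2))⁻¹ • pencilInverse E T s (E y) with hF
  have hFd : ∀ s : ℂ, γ ≤ s.re → DifferentiableAt ℂ F s := by
    intro s hs
    have h1 : DifferentiableAt ℂ (fun s => ((s - μ) ^ (p + 2))⁻¹) s :=
      DifferentiableAt.inv (by fun_prop)
        (pow_ne_zero _ (sub_ne_zero_of_re (hμγ.trans hs) (by linarith)))
    exact h1.smul (differentiableAt_pencilInverse_of_growth hg (hωγ.trans_le hs)
      (norm_pos_iff.1 (by linarith [hpos s hs])) (E y))
  set C' : ℝ := 2 ^ (p + 2) * C * ‖E y‖ with hC'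
  have hFb : ∀ s : ℂ, γ ≤ s.re → ‖F s‖ ≤ C' * (‖s‖ ^ 3)⁻¹ := by
    intro s hs
    have h1 := norm_inv_pow_sub_le (hμγ.trans hs) (by linarith) (p + 2)
    have h2 := (pencilInverse E T s).le_of_opNorm_le (hg s (hωγ.trans_le hs)).2 (E y)
    have h3 : ‖s‖ ≠ 0 := by linarith [hpos s hs]
    rw [hF, norm_smul]
    refine (mul_le_mul h1 h2 (norm_nonneg _) (by positivity)).trans (le_of_eq ?_)
    have h4 : ‖s‖ ^ ((p : ℤ) - 1) = ‖s‖ ^ p * ‖s‖⁻¹ := by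
      rw [zpow_sub₀ h3, zpow_natCast, zpow_one, div_eq_mul_inv]
    rw [h4, hC']
    field_simp
    ring
  have hFb2 : ∀ s : ℂ, γ ≤ s.re → ‖F s‖ ≤ C' * (‖s‖ ^ 2)⁻¹ := by
    intro s hs
    have h1 := hpos s hs
    refine (hFb s hs).trans ?_
    gcongr
    norm_num
  set g : ℝ → X := fun ξ => F (vertLine γ ξ) with hgdef
  have hgc : Continuous g := continuous_iff_continuousAt.2 fun ξ =>
    ContinuousAt.comp (f := vertLine γ) (hFd (vertLine γ ξ) (by simp)).continuousAt
      (continuous_vertLine γ).continuousAt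
  have hgi : Integrable g := integrable_of_norm_le_vertLine hγ hgc fun ξ => hFb2 _ (by simp)
  have hgi' : Integrable fun ξ => vertLine γ ξ • g ξ := by
    refine integrable_of_norm_le_vertLine (C := C') hγ ((continuous_vertLine γ).smul hgc)
      fun ξ => ?_
    have h1 := hpos (vertLine γ ξ) (by simp)
    rw [norm_smul]
    calc ‖vertLine γ ξ‖ * ‖g ξ‖ ≤ ‖vertLine γ ξ‖ * (C' * (‖vertLine γ ξ‖ ^ 3)⁻¹) := by
          gcongr
          exact hFb _ (by simp)
      _ = _ := by field_simp
  refine ⟨fun t => ∫ ξ, cexp (t * vertLine γ ξ) • g ξ,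
    fun t => E (∫ ξ, cexp (t * vertLine γ ξ) • vertLine γ ξ • g ξ),
    continuous_integral_exp_vertLine_smul γ hgi,
    E.continuous.comp (continuous_integral_exp_vertLine_smul γ hgi'), ?_, fun t => ⟨?_, ?_⟩⟩
  · simpa using integral_vertLine_eq_zero hγ hFd hFb2
  · exact (E.restrictScalars ℝ).hasFDerivAt.comp_hasDerivAt t
      (hasDerivAt_integral_exp_vertLine_smul γ t hgi hgi')
  · intro ht
    beta_reduce
    rw [← integral_exp_vertLine_mul_inv_pow hγ hμγ (by omega : 1 ≤ p + 1) ht,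
      ← integral_smul_const, ← E.integral_comp_comm (integrable_exp_vertLine_smul γ t hgi')]
    -- It suffices to exhibit `u t` as the value of `(μE - T)⁻¹` at `μ E u - (E u)' + q E y`; under
    -- the integral sign this is the resolvent identity.
    set S := pencilInverse E T μ with hS
    have hI1 : Integrable fun ξ => μ • E (cexp (t * vertLine γ ξ) • g ξ) :=
      (E.integrable_comp (integrable_exp_vertLine_smul γ t hgi)).smul μ
    have hI2 := E.integrable_comp (integrable_exp_vertLine_smul γ t hgi')
    have hI12 : Integrable fun ξ => μ • E (cexp (t * vertLine γ ξ) • g ξ) -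
        E (cexp (t * vertLine γ ξ) • vertLine γ ξ • g ξ) := hI1.sub hI2
    have hI3 : Integrable fun ξ =>
        (cexp (t * vertLine γ ξ) * ((vertLine γ ξ - μ) ^ (p + 2))⁻¹) • E y :=
      (integrable_exp_vertLine_smul γ t
      (integrable_inv_pow_vertLine_sub hγ hμγ (by omega : 2 ≤ p + 2))).smul_const (E y)
    have hkey : S (μ • E (∫ ξ, cexp (t * vertLine γ ξ) • g ξ) -
        (∫ ξ, E (cexp (t * vertLine γ ξ) • vertLine γ ξ • g ξ)) +
        ∫ ξ, (cexp (t * vertLine γ ξ) * ((vertLine γ ξ - μ) ^ (p + 2))⁻¹) • E y) =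
        ∫ ξ, cexp (t * vertLine γ ξ) • g ξ := by
      rw [← E.integral_comp_comm (integrable_exp_vertLine_smul γ t hgi), ← integral_smul,
        ← integral_sub hI1 hI2, ← integral_add hI12 hI3,
        ← S.integral_comp_comm (hI12.fun_add hI3)]
      refine integral_congr_ae (ae_of_all _ fun ξ => ?_)
      set s := vertLine γ ξ with hs
      have hres := pencilInverse_sub_pencilInverse hμ (hg s (by simpa [hs] using hωγ)).1 (E y)
      rw [sub_eq_iff_eq_add, ← hS] at hres
      simp only [hgdef, hF, ← hs, map_add, map_sub, map_smul, hres]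
      module
    have := mem_graph_pencilInverse hμ (μ • E (∫ ξ, cexp (t * vertLine γ ξ) • g ξ) -
        (∫ ξ, E (cexp (t * vertLine γ ξ) • vertLine γ ξ • g ξ)) +
        ∫ ξ, (cexp (t * vertLine γ ξ) * ((vertLine γ ξ - μ) ^ (p + 2))⁻¹) • E y)
    rw [← hS, hkey] at this
    convert this using 2
    abel

/-- On `ran ((μE - T)⁻¹E)ᵖ⁺²` the defects of the two preceding constructions cancel. -/
theorem exists_isClassicalSolution [CompleteSpace X] [CompleteSpace Z] {p : ℕ}
    (hp : HasComplexResolventGrowth E T p) {μ : ℂ} (hμ : μ ∈ resolventSet E T) (y : X) :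
    ∃ x : ℝ → X, IsClassicalSolution E T
      (((pencilInverse E T μ ∘L E) ^ (p + 2) : X →L[ℂ] X) y) x := by
  obtain ⟨v, d, hv, hd, hv0, hvd⟩ := exists_solution_with_defect hμ (p + 1) y
  obtain ⟨u, e, hu, he, hu0, hue⟩ := exists_solution_of_inhomogeneous hp hμ y
  set x : ℝ → X := fun t => v t + (-1 : ℂ) ^ (p + 2) • u t with hx
  set f : ℝ → Z := fun t => d t + (-1 : ℂ) ^ (p + 2) • e t with hf
  have hderiv : ∀ t, HasDerivAt (fun t => E (x t)) (f t) t := fun t => by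
    simpa [hx] using (hvd t).1.fun_add ((hue t).1.fun_const_smul ((-1 : ℂ) ^ (p + 2)))
  have hgraph : ∀ t, 0 ≤ t → (x t, f t) ∈ T.graph := fun t ht => by
    have := T.graph.add_mem (hvd t).2 (T.graph.smul_mem ((-1 : ℂ) ^ (p + 2)) ((hue t).2 ht))
    convert this using 1
    refine Prod.ext rfl ?_
    simp only [hf, Prod.snd_add, Prod.smul_snd, smul_sub, smul_smul, neg_pow (t : ℂ)]
    rw [pow_succ (-1 : ℂ) (p + 1)]
    module
  have hmem : ∀ t, 0 ≤ t → x t ∈ T.domain := fun t ht =>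
    LinearPMap.mem_domain_of_mem_graph (hgraph t ht)
  refine ⟨x, ?_, ?_, hmem, ?_, fun t ht => ?_⟩
  · exact (hv.add (hu.const_smul _)).continuousOn
  · refine ContDiff.contDiffOn (contDiff_one_iff_deriv.2
      ⟨fun t => (hderiv t).differentiableAt, ?_⟩)
    rw [funext fun t => (hderiv t).deriv]
    fun_prop
  · simp [hx, hv0, hu0]
  · obtain ⟨w, hw, hw'⟩ := T.mem_graph_iff.1 (hgraph t ht)
    have : (⟨x t, hmem t ht⟩ : T.domain) = w := Subtype.ext hw.symm
    rw [this, hw']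
    exact (hderiv t).hasDerivWithinAt

end Pencil

section PortHamiltonian

/-! ### Energy and resolvent growth -/

variable {X Z : Type*}
  [NormedAddCommGroup X] [InnerProductSpace ℂ X] [CompleteSpace X]
  [NormedAddCommGroup Z] [InnerProductSpace ℂ Z] [CompleteSpace Z]
  {E Q : X →L[ℂ] Z} {A : Z →ₗ.[ℂ] Z}

namespace IsPortHamiltonian

theorem inner_symm (h : IsPortHamiltonian E Q A) (x y : X) :
    inner ℂ (E x) (Q y) = inner ℂ (Q x) (E y) := by
  have h1 := congrArg (fun B : X →L[ℂ] X => inner ℂ x (B y)) h.symmetric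
  simpa [ContinuousLinearMap.adjoint_inner_right] using h1

theorem inner_self_im (h : IsPortHamiltonian E Q A) (x : X) : (inner ℂ (E x) (Q x)).im = 0 := by
  have h1 := h.inner_symm x x
  rw [← inner_conj_symm (Q x)] at h1
  exact Complex.conj_eq_iff_im.1 h1.symm

theorem inner_self_nonneg (h : IsPortHamiltonian E Q A) (x : X) :
    0 ≤ (inner ℂ (E x) (Q x)).re := by
  have h1 := h.nonneg.re_inner_nonneg_right x
  simpa [ContinuousLinearMap.adjoint_inner_right] using h1

/-- The energy `⟨E x, Q x⟩` controls `E x`. This is the Cauchy–Schwarz inequality of the form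
`⟨E ·, Q ·⟩` together with the invertibility of `Q`. -/
theorem exists_norm_sq_le (h : IsPortHamiltonian E Q A) :
    ∃ k : ℝ, 0 < k ∧ ∀ x, ‖E x‖ ^ 2 ≤ k * (inner ℂ (E x) (Q x)).re := by
  set B : X →L[ℂ] X := E.adjoint ∘L Q with hB
  have hBre : ∀ x, (inner ℂ x (B x)).re = (inner ℂ (E x) (Q x)).re := fun x => by
    simp [hB, ContinuousLinearMap.adjoint_inner_right]
  have hBsq : ∀ x, ‖B x‖ ^ 2 ≤ (‖B‖ + 1) * (inner ℂ x (B x)).re := by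
    intro x
    -- Positivity of the form at `c x - B x`, `c = ‖B‖ + 1`, is the Cauchy–Schwarz estimate needed.
    have h1 := h.nonneg.re_inner_nonneg_right (((‖B‖ + 1 : ℝ) : ℂ) • x - B x)
    have h2 : (inner ℂ (B x) (B (B x))).re ≤ ‖B‖ * ‖B x‖ ^ 2 := by
      calc (inner ℂ (B x) (B (B x))).re ≤ ‖B x‖ * ‖B (B x)‖ := re_inner_le_norm (𝕜 := ℂ) _ _
        _ ≤ ‖B x‖ * (‖B‖ * ‖B x‖) := by gcongr; exact B.le_opNorm _
        _ = _ := by ring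
    have h3 : inner ℂ x (B (B x)) = inner ℂ (B x) (B x) :=
      (h.nonneg.inner_left_eq_inner_right x (B x)).symm
    have h4 : (inner ℂ (B x) (B x)).re = ‖B x‖ ^ 2 := inner_self_eq_norm_sq (𝕜 := ℂ) _
    have h5 : RCLike.re (inner ℂ (((‖B‖ + 1 : ℝ) : ℂ) • x - B x)
        (B (((‖B‖ + 1 : ℝ) : ℂ) • x - B x))) = (‖B‖ + 1) ^ 2 * (inner ℂ x (B x)).re -
          2 * (‖B‖ + 1) * ‖B x‖ ^ 2 + (inner ℂ (B x) (B (B x))).re := by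
      rw [← h4]
      simp only [map_sub, map_smul, inner_sub_left, inner_sub_right, inner_smul_left,
        inner_smul_right, h3, Complex.conj_ofReal, RCLike.re_to_complex, Complex.re_ofReal_mul,
        Complex.sub_re]
      ring
    have hc : 0 < ‖B‖ + 1 := by positivity
    rw [h5] at h1
    refine le_of_mul_le_mul_left ?_ hc
    nlinarith [sq_nonneg ‖B x‖]
  obtain ⟨e, he⟩ := h.invertible
  obtain ⟨c, hc0, hc⟩ : ∃ c : ℝ, 0 < c ∧ ∀ x, ‖E x‖ ≤ c * ‖B x‖ := by
    -- With `L = Q⁻¹` and `B = Q* E`, the operator `L*` recovers `E x` from `B x`.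
    set L : Z →L[ℂ] X := (e.symm : Z ≃L[ℂ] X).toContinuousLinearMap
    refine ⟨‖L.adjoint‖ + 1, by positivity, fun x => ?_⟩
    have h1 : L.adjoint (B x) = E x := by
      refine ext_inner_right ℂ fun z => ?_
      have hQL : Q (L z) = z := by rw [← he]; exact e.apply_symm_apply z
      rw [ContinuousLinearMap.adjoint_inner_left, hB, h.symmetric, ContinuousLinearMap.comp_apply,
        ContinuousLinearMap.adjoint_inner_left, hQL]
    calc ‖E x‖ = ‖L.adjoint (B x)‖ := by rw [h1]
      _ ≤ ‖L.adjoint‖ * ‖B x‖ := L.adjoint.le_opNorm _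
      _ ≤ _ := by gcongr; linarith
  refine ⟨c ^ 2 * (‖B‖ + 1), by positivity, fun x => ?_⟩
  calc ‖E x‖ ^ 2 ≤ (c * ‖B x‖) ^ 2 := by gcongr; exact hc x
    _ = c ^ 2 * ‖B x‖ ^ 2 := by ring
    _ ≤ c ^ 2 * ((‖B‖ + 1) * (inner ℂ x (B x)).re) := by gcongr; exact hBsq x
    _ = _ := by rw [hBre]; ring

theorem re_inner_le_zero (h : IsPortHamiltonian E Q A) {x : X} {w : Z}
    (hx : (x, w) ∈ (mulBounded A Q).graph) : (inner ℂ w (Q x)).re ≤ 0 := by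
  obtain ⟨y, rfl, rfl⟩ := (mulBounded A Q).mem_graph_iff.1 hx
  exact h.dissipative ⟨Q y, y.2⟩

/-- Dissipativity bounds `E x`, `x = (sE - AQ)⁻¹ z`, by the geometric mean of `‖x‖` and `‖z‖`.
The resolvent identity bounds `x` by `z` and `s E x`, which gives quadratic growth. -/
theorem hasComplexResolventGrowth_three (h : IsPortHamiltonian E Q A) {ω : ℝ} (hω : 0 < ω)
    (hρ : {s : ℂ | ω < s.re} ⊆ resolventSet E (mulBounded A Q)) :
    HasComplexResolventGrowth E (mulBounded A Q) 3 := by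
  set T := mulBounded A Q with hT
  obtain ⟨k, hk, hkE⟩ := h.exists_norm_sq_le
  set r : ℂ := ((ω + 1 : ℝ) : ℂ) with hr
  have hrρ : r ∈ resolventSet E T := hρ (by simp [hr])
  have hrn : ‖r‖ = ω + 1 := by rw [hr, Complex.norm_real, Real.norm_of_nonneg (by linarith)]
  set M := ‖pencilInverse E T r‖ with hM
  have hM0 : 0 ≤ M := norm_nonneg _
  refine ⟨ω + 1, 2 * M + 4 * M ^ 2 * k * ‖Q‖ + 1, by positivity, fun s hs => ?_⟩
  have hsρ : s ∈ resolventSet E T := hρ (show ω < s.re by linarith)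
  refine ⟨hsρ, ContinuousLinearMap.opNorm_le_bound _ (by positivity) fun z => ?_⟩
  have hsn : ω + 1 ≤ ‖s‖ := hs.le.trans ((le_abs_self _).trans (Complex.abs_re_le_norm s))
  set x := pencilInverse E T s z with hx
  have hE : ‖E x‖ ^ 2 ≤ k * (‖Q‖ * (‖z‖ * ‖x‖)) := by
    refine (hkE x).trans (mul_le_mul_of_nonneg_left ?_ hk.le)
    have h1 := h.re_inner_le_zero (mem_graph_pencilInverse hsρ z)
    rw [← hx, inner_sub_left, inner_smul_left, Complex.sub_re, Complex.mul_re,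
      h.inner_self_im, mul_zero, sub_zero, Complex.conj_re] at h1
    have h2 : (inner ℂ z (Q x)).re ≤ ‖z‖ * (‖Q‖ * ‖x‖) :=
      (re_inner_le_norm (𝕜 := ℂ) _ _).trans (by gcongr; exact Q.le_opNorm _)
    nlinarith [h.inner_self_nonneg x]
  have hxb : ‖x‖ ≤ M * ‖z‖ + 2 * ‖s‖ * M * ‖E x‖ := by
    have h1 := pencilInverse_sub_pencilInverse hrρ hsρ z
    rw [← hx, sub_eq_iff_eq_add, ← sub_eq_iff_eq_add'] at h1
    refine (congrArg norm h1).ge.trans ((norm_sub_le _ _).trans (add_le_add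
      (ContinuousLinearMap.le_opNorm _ _) ?_))
    rw [norm_smul]
    calc ‖s - r‖ * ‖pencilInverse E T r (E x)‖ ≤ (2 * ‖s‖) * (M * ‖E x‖) := by
          gcongr
          · exact (norm_sub_le _ _).trans (by linarith)
          · exact ContinuousLinearMap.le_opNorm _ _
      _ = _ := by ring
  have h2 : (2 * ‖s‖ * M * ‖E x‖) ^ 2 ≤ (4 * ‖s‖ ^ 2 * M ^ 2 * k * ‖Q‖ * ‖z‖) * ‖x‖ := by
    calc (2 * ‖s‖ * M * ‖E x‖) ^ 2 = 4 * ‖s‖ ^ 2 * M ^ 2 * ‖E x‖ ^ 2 := by ring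
      _ ≤ 4 * ‖s‖ ^ 2 * M ^ 2 * (k * (‖Q‖ * (‖z‖ * ‖x‖))) := by gcongr
      _ = _ := by ring
  have hx0 := norm_nonneg x
  have hz0 := norm_nonneg z
  have hD : 0 ≤ 4 * ‖s‖ ^ 2 * M ^ 2 * k * ‖Q‖ * ‖z‖ := by positivity
  -- By the arithmetic-geometric mean inequality half of `‖x‖` can be absorbed on the left.
  have h3 : 2 * ‖s‖ * M * ‖E x‖ ≤ (4 * ‖s‖ ^ 2 * M ^ 2 * k * ‖Q‖ * ‖z‖ + ‖x‖) / 2 := by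
    refine abs_le_of_sq_le_sq' (h2.trans ?_) (by positivity) |>.2
    nlinarith [sq_nonneg (4 * ‖s‖ ^ 2 * M ^ 2 * k * ‖Q‖ * ‖z‖ - ‖x‖)]
  have h4 : ‖x‖ ≤ 2 * M * ‖z‖ + 4 * ‖s‖ ^ 2 * M ^ 2 * k * ‖Q‖ * ‖z‖ := by linarith
  have h5 : 1 ≤ ‖s‖ ^ 2 := one_le_pow₀ (by linarith)
  have h6 : ‖s‖ ^ (((3 : ℕ) : ℤ) - 1) = ‖s‖ ^ 2 := by
    rw [show ((3 : ℕ) : ℤ) - 1 = (2 : ℕ) by norm_num, zpow_natCast]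
  rw [h6]
  have h7 : 2 * M * ‖z‖ ≤ 2 * M * ‖z‖ * ‖s‖ ^ 2 := le_mul_of_one_le_right (by positivity) h5
  nlinarith [mul_nonneg hz0 (sq_nonneg ‖s‖)]

/-! ### Uniqueness -/

/-- The energy `⟨E x, Q x⟩` is differentiable along a solution even though only `E x` is, because
its difference quotient is `⟨Δ E x, Q x(t)⟩ + ⟨Q x(s), Δ E x⟩` by symmetry. -/
theorem hasDerivWithinAt_energy (h : IsPortHamiltonian E Q A) {x : ℝ → X} {s : Set ℝ} {t : ℝ}
    {w : Z} (hx : ContinuousWithinAt x s t)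
    (hd : HasDerivWithinAt (fun τ => E (x τ)) w s t) :
    HasDerivWithinAt (fun τ => (inner ℂ (E (x τ)) (Q (x τ))).re)
      (2 * (inner ℂ w (Q (x t))).re) s t := by
  rw [hasDerivWithinAt_iff_tendsto_slope] at hd ⊢
  have hQ : Tendsto (fun τ => Q (x τ)) (𝓝[s \ {t}] t) (𝓝 (Q (x t))) :=
    (Q.continuous.tendsto _).comp (hx.mono sdiff_subset)
  have hlim := (Complex.continuous_re.tendsto _).comp
    ((hd.inner (𝕜 := ℂ) hQ).add ((tendsto_const_nhds (x := Q (x t))).inner (𝕜 := ℂ) hd))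
  have hval : (inner ℂ w (Q (x t)) + inner ℂ (Q (x t)) w).re = 2 * (inner ℂ w (Q (x t))).re := by
    rw [← inner_conj_symm (Q (x t)), Complex.add_re, Complex.conj_re]
    ring
  rw [hval] at hlim
  refine hlim.congr fun τ => ?_
  have hre : ∀ c : ℝ, ∀ a : Z, (c • a) = (c : ℂ) • a := fun c a => (Complex.coe_smul c a).symm
  simp only [Function.comp_apply, slope_def_module, hre, inner_smul_left, inner_smul_right,
    inner_sub_left, inner_sub_right, Complex.conj_ofReal, ← mul_add, Complex.re_ofReal_mul,
    smul_eq_mul, ← h.inner_symm]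
  simp only [Complex.add_re, Complex.sub_re]
  ring

/-- Solutions starting at `0` vanish: their energy is nonnegative, nonincreasing and initially `0`,
so `E x` vanishes, hence so does `A Q x`, and `sE - AQ` is injective for some `s`. -/
theorem eq_zero_of_initial_zero (h : IsPortHamiltonian E Q A) {r : ℂ}
    (hr : r ∈ resolventSet E (mulBounded A Q)) {x : ℝ → X} {w : ℝ → Z}
    (hx : ContinuousOn x (Ici 0))
    (h0 : x 0 = 0) (hd : ∀ t, 0 ≤ t → HasDerivWithinAt (fun τ => E (x τ)) (w t) (Ici 0) t)
    (hg : ∀ t, 0 ≤ t → (x t, w t) ∈ (mulBounded A Q).graph) :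
    ∀ t, 0 ≤ t → x t = 0 := by
  obtain ⟨k, hk, hkE⟩ := h.exists_norm_sq_le
  have hen : ∀ t, 0 ≤ t → HasDerivWithinAt (fun τ => (inner ℂ (E (x τ)) (Q (x τ))).re)
      (2 * (inner ℂ (w t) (Q (x t))).re) (Ici 0) t := fun t ht =>
    h.hasDerivWithinAt_energy (hx t ht) (hd t ht)
  have hanti : AntitoneOn (fun τ => (inner ℂ (E (x τ)) (Q (x τ))).re) (Ici 0) := by
    refine antitoneOn_of_hasDerivWithinAt_nonpos (convex_Ici 0)
      (fun t ht => (hen t ht).continuousWithinAt)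
      (fun t ht => (hen t (interior_subset ht)).mono interior_subset) fun t ht => ?_
    have := h.re_inner_le_zero (hg t (interior_subset ht))
    linarith
  have hE0 : ∀ t, 0 ≤ t → E (x t) = 0 := by
    intro t ht
    have h1 := hanti self_mem_Ici ht ht
    simp only [h0, map_zero, inner_zero_left, Complex.zero_re] at h1
    have h2 := hkE (x t)
    have h3 : ‖E (x t)‖ ^ 2 ≤ 0 := h2.trans (mul_nonpos_of_nonneg_of_nonpos hk.le h1)
    simpa using le_antisymm h3 (sq_nonneg _)
  intro t ht
  have hw : w t = 0 := by
    refine (uniqueDiffOn_Ici (0 : ℝ) t ht).eq_deriv _ (hd t ht) ?_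
    exact (hasDerivWithinAt_const t (Ici 0) (0 : Z)).congr (fun τ hτ => hE0 τ hτ) (hE0 t ht)
  have h4 := pencilInverse_of_mem_graph hr (hg t ht)
  rw [hE0 t ht, hw, smul_zero, sub_zero, map_zero] at h4
  exact h4.symm

theorem eqOn_of_isClassicalSolution (h : IsPortHamiltonian E Q A) {r : ℂ}
    (hr : r ∈ resolventSet E (mulBounded A Q)) {x₀ : X} {x y : ℝ → X}
    (hx : IsClassicalSolution E (mulBounded A Q) x₀ x)
    (hy : IsClassicalSolution E (mulBounded A Q) x₀ y) : EqOn y x (Ici 0) := by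
  set T := mulBounded A Q with hT
  have hgraph : ∀ {v : ℝ → X} (hv : IsClassicalSolution E T x₀ v) (t : ℝ), 0 ≤ t →
      ∃ w : Z, (v t, w) ∈ T.graph ∧ HasDerivWithinAt (fun τ => E (v τ)) w (Ici 0) t :=
    fun hv t ht => ⟨_, T.mem_graph ⟨_, hv.mem_domain t ht⟩, hv.equation t ht⟩
  choose! a ha ha' using hgraph hx
  choose! b hb hb' using hgraph hy
  intro t ht
  refine sub_eq_zero.1 (h.eq_zero_of_initial_zero hr (x := fun t => y t - x t)
    (w := fun t => b t - a t) (hy.continuousOn.sub hx.continuousOn)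
    (by simp [hx.initial, hy.initial]) (fun t ht => ?_)
    (fun t ht => T.graph.sub_mem (hb t ht) (ha t ht)) t ht)
  simpa using (hb' t ht).fun_sub (ha' t ht)

end IsPortHamiltonian

end PortHamiltonian

end PHDAE

theorem mainTheorem12 {X Z : Type*}
    [NormedAddCommGroup X] [InnerProductSpace ℂ X] [CompleteSpace X]
    [NormedAddCommGroup Z] [InnerProductSpace ℂ Z] [CompleteSpace Z]
    (E Q : X →L[ℂ] Z) (A : Z →ₗ.[ℂ] Z) (hpH : PHDAE.IsPortHamiltonian E Q A)
    (ω : ℝ) (hω : 0 < ω)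
    (hρ : {s : ℂ | ω < s.re} ⊆ PHDAE.resolventSet E (PHDAE.mulBounded A Q)) :
    ∃ p : ℕ, PHDAE.IsComplexResolventIndex E (PHDAE.mulBounded A Q) p ∧
      ∀ μ ∈ PHDAE.resolventSet E (PHDAE.mulBounded A Q),
        ∀ x₀ ∈ Set.range
          ((PHDAE.pencilInverse E (PHDAE.mulBounded A Q) μ ∘L E) ^ (p + 2) : X →L[ℂ] X),
          ∃ x : ℝ → X, PHDAE.IsClassicalSolution E (PHDAE.mulBounded A Q) x₀ x ∧
            ∀ y : ℝ → X, PHDAE.IsClassicalSolution E (PHDAE.mulBounded A Q) x₀ y →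
              Set.EqOn y x (Set.Ici 0) := by
  classical
  have hex : ∃ p, PHDAE.HasComplexResolventGrowth E (PHDAE.mulBounded A Q) p :=
    ⟨3, hpH.hasComplexResolventGrowth_three hω hρ⟩
  refine ⟨Nat.find hex, ⟨Nat.find_spec hex, fun q hq => Nat.find_min' hex hq⟩, ?_⟩
  rintro μ hμ _ ⟨y, rfl⟩
  obtain ⟨x, hx⟩ := PHDAE.exists_isClassicalSolution (Nat.find_spec hex) hμ y
  exact ⟨x, hx, fun y hy => hpH.eqOn_of_isClassicalSolution hμ hx hy⟩
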